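/- Let $D\ge 1$, $\mu>0$, $\alpha:=D\mu$, and let $E=(D\mu)^{-1}I$ be a multiple of the $D\times D$ identity matrix. For every $t>0$ let $\vec L_t$ be an $\mathbb R^D$-valued random vector that is the limit in distribution $$\vec L_t=\lim_{n\to\infty} n^{-E}\sum_{i=1}^{\lfloor nt\rfloor}\vec X_i ,\qquad n^{-E}=\exp(-E\ln n),$$ where $\vec X_1,\vec X_2,\dots$ are independent, identically distributed random vectors. Let $\phi$ be the negative logarithmic characteristic function of $\vec L_1$, that is, the continuous function with $\phi(0)=0$ and $\mathbb E[e^{i\vec k\cdot\vec L_1}]=e^{-\phi(\vec k)}$, and assume $\phi(\vec k)=\phi(-\vec k)$ for all $\vec k$. Let $\vec\sigma\in\mathbb R^D\setminus\{0\}$, $\sigma:=|\vec\sigma|$, and $\phi_\pm:=\phi(\vec\sigma/\sigma)=\phi(-\vec\sigma/\sigma)$. For a real number $x<0$ and real $\beta$ the power $x^\beta$ is the principal value $|x|^\beta e^{i\pi\beta}$. Let $t>0$. (a) Let $-1<\beta<D\mu$, and suppose that $\phi_\pm\neq0$ in case $\beta<0$. Then the moment $\mathbb E[(\vec\sigma\cdot\vec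 L_t)^\beta]$ exists (that is, $(\vec\sigma\cdot\vec L_t)^\beta$ is integrable), and if $\beta\ne0$, it equals $$\mathbb E\big[(\vec\sigma\cdot\vec L_t)^\beta\big]=\mathfrak C(\beta,D\mu)\cdot\big(\sigma\,t^{1/(D\mu)}\big)^\beta\cdot\Big(\cos\big(\tfrac{\pi\beta}{2}\big)e^{i\beta\pi/2}\Big)\cdot\phi_\pm^{\beta/(D\mu)},$$ where $$\mathfrak C(\beta,\alpha)=\frac{2^{\beta+1}}{\alpha\sqrt\pi}\,\Gamma\Big(\frac{\beta+1}{2}\Big)\frac{\Gamma(-\beta/\alpha)}{\Gamma(-\beta/2)}$$ (with $1/\Gamma$ read as $0$ at the poles of $\Gamma$). (b) If $D\mu<2$ (the non-Gaussian case) and $\phi_\pm\ne0$, the bound is sharp: for every $\beta\ge D\mu$ the variable $(\vec\sigma\cdot\vec L_t)^\beta$ is not integrable. -/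

import Mathlib

open MeasureTheory ProbabilityTheory Filter Topology

noncomputable section

/-- The matrix power `r ^ A = exp (A log r)` of a positive real `r`. -/
def realMatrixPow {D : ℕ} (r : ℝ) (A : Matrix (Fin D) (Fin D) ℝ) : Matrix (Fin D) (Fin D) ℝ :=
  NormedSpace.exp (Real.log r • A)

/-- The random vectors `L t`, `t > 0`, are the operator-normalized limits
`L t = lim_{n → ∞} n ^ (-E) ∑_{i < ⌊n t⌋} X i` (limits in distribution) of partial sums of the
independent, identically distributed random vectors `X i`. -/
structure IsStrictlyOperatorStableLimit {D : ℕ} {Ω Ω' : Type*}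
    [MeasurableSpace Ω] [MeasurableSpace Ω']
    (P : Measure Ω) [IsProbabilityMeasure P] (P' : Measure Ω') [IsProbabilityMeasure P']
    (E : Matrix (Fin D) (Fin D) ℝ)
    (L : ℝ → Ω → EuclideanSpace ℝ (Fin D)) (X : ℕ → Ω' → EuclideanSpace ℝ (Fin D)) : Prop where
  indep : iIndepFun X P'
  identDistrib : ∀ i, IdentDistrib (X i) (X 0) P' P'
  tendsto : ∀ t : ℝ, 0 < t →
    TendstoInDistribution
      (fun (n : ℕ) ω ↦ Matrix.toEuclideanCLM (𝕜 := ℝ) (realMatrixPow (n : ℝ) (-E))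
        (∑ i ∈ Finset.range ⌊(n : ℝ) * t⌋₊, X i ω))
      atTop (L t) (fun _ ↦ P') P

/-- `φ` is the negative logarithm of the characteristic function of the law `ν`: the continuous
function with `φ 0 = 0` and `∫ exp (i ⟪x, k⟫) dν(x) = exp (-φ k)`. -/
structure IsNegLogCharFun {D : ℕ} (φ : EuclideanSpace ℝ (Fin D) → ℂ)
    (ν : Measure (EuclideanSpace ℝ (Fin D))) : Prop where
  continuous : Continuous φ
  map_zero : φ 0 = 0
  charFun_eq : ∀ k, charFun ν k = Complex.exp (-φ k)

/-- The prefactor `2 ^ (β + 1) / (α √π) · Γ((β + 1) / 2) · Γ(-β / α) / Γ(-β / 2)`. -/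
def fracMomentConst (β α : ℝ) : ℝ :=
  2 ^ (β + 1) / (α * √Real.pi) * Real.Gamma ((β + 1) / 2) *
    (Real.Gamma (-β / α) / Real.Gamma (-β / 2))

/-- The real power `(σ · L) ^ β` of the scalar product. For a negative base this is the principal
value, `x ^ β = |x| ^ β * exp (i π β)`. -/
def projPow {D : ℕ} {Ω : Type*} (σ : EuclideanSpace ℝ (Fin D))
    (L : Ω → EuclideanSpace ℝ (Fin D)) (β : ℝ) (ω : Ω) : ℂ :=
  ((inner ℝ σ (L ω) : ℝ) : ℂ) ^ (β : ℂ)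

end

/-!
The random variable `W = ⟪σ, L t⟫` turns out to have the characteristic function
`exp (-c |s| ^ α)` with `α = D μ` and `c = (‖σ‖ t ^ (1 / α)) ^ α φ(σ / ‖σ‖) ≥ 0`
(`charFun_map_inner`), and the moments of a law on the line with this characteristic function can be
computed.

*The law of `W`.* The normalization is the scalar `n ^ (-1 / α)`. Comparing the partial sums at `n`
and at `⌊n t⌋`, Slutsky's theorem gives `L t = t ^ (1 / α) L 1` in law, while the characteristic
function of a sum of independent variables being a power gives
`|E exp (i ⟪k, L t⟫)| = |E exp (i ⟪k, L 1⟫)| ^ t`. An even `φ` is real by continuity. The two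
descriptions of the modulus therefore yield `φ (r k) = r ^ α φ k` for `r > 0`.

*The moments.* Let `g` be a standard Gaussian variable independent of `W`. Conditioning on `W` and on
`g` in `E exp (i √(2u) g W)` gives `E exp (-u W²) = E exp (-c |√(2u) g| ^ α)` for `u ≥ 0`. Integrate
this identity (for `β < 0`), or the same identity between the complements to `1` (for `β > 0`),
against `u ^ (-β / 2 - 1) du`. All integrands are nonnegative, so Tonelli's theorem applies with
values in `[0, ∞]` and no integrability is needed beforehand. With `M b = ∫₀^∞ v ^ (-b - 1) k(v) dv`
for the kernel `k` in question (`kernelMellin`) the outcome is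

`E |W| ^ β · M (β / 2) = (2 / α) c ^ (β / α) 2 ^ (β / 2) · E |g| ^ β · M (β / α)`

(`lintegral_enorm_rpow_mul_kernelMellin`). Here `M b = |Γ(-b)|` for `b < 1`, `b ≠ 0`, and `M b = ∞`
for `b ≥ 1`, and this decides every case. For `β < 2` and `β < α` all factors are finite and the
formula for `E |W| ^ β` follows. For `2 ≤ β < α` the infinite factor on the left forces `W = 0`
almost surely and `c = 0`, and both sides of the moment formula vanish. For `β = α < 2` and `c > 0`
the infinite factor on the right forces `E |W| ^ α = ∞`, which is the sharpness. Finally the law of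
`W` is symmetric, so that averaging the principal power over `x` and `-x` produces the factor
`(1 + exp (i π β)) / 2 = cos (π β / 2) exp (i π β / 2)`.
-/

open scoped ENNReal

/-! ### Mellin integrals of `exp (-v)` and `1 - exp (-v)` -/

/-- The kernel `exp (-v)` for `b < 0` and `1 - exp (-v)` for `b ≥ 0`. -/
noncomputable def expKernel (b v : ℝ) : ℝ≥0∞ :=
  if b < 0 then ENNReal.ofReal (Real.exp (-v)) else ENNReal.ofReal (1 - Real.exp (-v))

/-- The Mellin integral `∫₀^∞ v ^ (-b - 1) k(v) dv`, with values in `[0, ∞]`, of the kernel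
`k = expKernel b`. -/
noncomputable def kernelMellin (b : ℝ) : ℝ≥0∞ :=
  ∫⁻ v in Set.Ioi (0 : ℝ), expKernel b v * ENNReal.ofReal (v ^ (-b - 1))

lemma measurable_expKernel (b : ℝ) : Measurable (expKernel b) := by
  unfold expKernel
  split_ifs <;> fun_prop

lemma expKernel_div (b v : ℝ) {p : ℝ} (hp : 0 < p) : expKernel (b / p) v = expKernel b v := by
  have : b / p < 0 ↔ b < 0 := by rw [div_lt_iff₀ hp, zero_mul]
  simp only [expKernel, this]

lemma kernelMellin_of_neg {b : ℝ} (hb : b < 0) :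
    kernelMellin b = ENNReal.ofReal (Real.Gamma (-b)) := by
  rw [Real.Gamma_eq_integral (neg_pos.2 hb), ofReal_integral_eq_lintegral_ofReal
    (Real.GammaIntegral_convergent (neg_pos.2 hb))]
  · refine setLIntegral_congr_fun measurableSet_Ioi fun v _ ↦ ?_
    simp only [expKernel, hb, if_true]
    rw [← ENNReal.ofReal_mul (Real.exp_pos _).le]
  · filter_upwards [ae_restrict_mem measurableSet_Ioi] with v hv
    exact mul_nonneg (Real.exp_pos _).le (Real.rpow_nonneg (le_of_lt hv) _)

/-- Writing `1 - exp (-v) = ∫₀^v exp (-s) ds` and exchanging the integrals. -/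
lemma kernelMellin_of_pos {b : ℝ} (hb : 0 < b) :
    kernelMellin b =
      ∫⁻ s in Set.Ioi (0 : ℝ), ENNReal.ofReal (Real.exp (-s) * (s ^ (-b) / b)) := by
  -- Both sides are iterated integrals of `exp (-s) v ^ (-b - 1)` over the region `0 < s < v`.
  have h1 : ∀ v ∈ Set.Ioi (0 : ℝ), expKernel b v * ENNReal.ofReal (v ^ (-b - 1)) =
      ∫⁻ s in Set.Ioi (0 : ℝ), (Set.Iio v).indicator
        (fun s ↦ ENNReal.ofReal (Real.exp (-s)) * ENNReal.ofReal (v ^ (-b - 1))) s := by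
    intro v hv
    have hv : 0 < v := hv
    rw [lintegral_indicator measurableSet_Iio, Measure.restrict_restrict measurableSet_Iio,
      Set.inter_comm, Set.Ioi_inter_Iio, lintegral_mul_const _ (by fun_prop)]
    congr 1
    have hint : IntervalIntegrable (fun s ↦ Real.exp (-s)) volume 0 v :=
      (by fun_prop : Continuous fun s : ℝ ↦ Real.exp (-s)).intervalIntegrable _ _
    have : ∫ s in Set.Ioo 0 v, Real.exp (-s) = 1 - Real.exp (-v) := by
      rw [← integral_Ioc_eq_integral_Ioo, ← intervalIntegral.integral_of_le hv.le]
      rw [intervalIntegral.integral_comp_neg (fun s ↦ Real.exp s)]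
      simp
    rw [← ofReal_integral_eq_lintegral_ofReal, this]
    · simp [expKernel, hb.le.not_gt]
    · exact (hint.1).mono_set Set.Ioo_subset_Ioc_self
    · exact Eventually.of_forall fun s ↦ (Real.exp_pos _).le
  have h2 : ∀ s ∈ Set.Ioi (0 : ℝ), ENNReal.ofReal (Real.exp (-s) * (s ^ (-b) / b)) =
      ∫⁻ v in Set.Ioi (0 : ℝ), (Set.Iio v).indicator
        (fun s ↦ ENNReal.ofReal (Real.exp (-s)) * ENNReal.ofReal (v ^ (-b - 1))) s := by
    intro s hs
    have hs : 0 < s := hs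
    have : ∀ v : ℝ, (Set.Iio v).indicator
        (fun s ↦ ENNReal.ofReal (Real.exp (-s)) * ENNReal.ofReal (v ^ (-b - 1))) s =
        (Set.Ioi s).indicator
        (fun v ↦ ENNReal.ofReal (Real.exp (-s)) * ENNReal.ofReal (v ^ (-b - 1))) v := by
      intro v; simp [Set.indicator_apply]
    simp_rw [this]
    rw [lintegral_indicator measurableSet_Ioi, Measure.restrict_restrict measurableSet_Ioi,
      Set.Ioi_inter_Ioi, sup_of_le_left hs.le, lintegral_const_mul _ (by fun_prop),
      ENNReal.ofReal_mul (Real.exp_pos _).le]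
    congr 1
    rw [← ofReal_integral_eq_lintegral_ofReal, integral_Ioi_rpow_of_lt (by linarith) hs]
    · congr 1
      rw [show -b - 1 + 1 = -b by ring, neg_div_neg_eq]
    · exact integrableOn_Ioi_rpow_of_lt (by linarith) hs
    · filter_upwards [ae_restrict_mem measurableSet_Ioi] with v hv
      exact Real.rpow_nonneg (hs.trans hv).le _
  rw [kernelMellin, setLIntegral_congr_fun measurableSet_Ioi h1,
    setLIntegral_congr_fun measurableSet_Ioi h2, lintegral_lintegral_swap]
  refine Measurable.aemeasurable ?_
  have : (Function.uncurry fun v s : ℝ ↦ (Set.Iio v).indicator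
      (fun s ↦ ENNReal.ofReal (Real.exp (-s)) * ENNReal.ofReal (v ^ (-b - 1))) s) =
      {q : ℝ × ℝ | q.2 < q.1}.indicator
      (fun q ↦ ENNReal.ofReal (Real.exp (-q.2)) * ENNReal.ofReal (q.1 ^ (-b - 1))) := by
    ext q; simp [Function.uncurry, Set.indicator_apply]
  rw [this]
  exact Measurable.indicator (by fun_prop) (measurableSet_lt measurable_snd measurable_fst)

lemma kernelMellin_eq_abs_Gamma {b : ℝ} (hb : b < 1) (hb0 : b ≠ 0) :
    kernelMellin b = ENNReal.ofReal |Real.Gamma (-b)| := by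
  rcases hb0.lt_or_gt with h | h
  · rw [kernelMellin_of_neg h, abs_of_pos (Real.Gamma_pos_of_pos (neg_pos.2 h))]
  · have hG : Real.Gamma (1 - b) / b = -Real.Gamma (-b) := by
      have := Real.Gamma_add_one (s := -b) (by linarith)
      rw [show -b + 1 = 1 - b by ring] at this
      rw [this]; field_simp
    have hpos : 0 < Real.Gamma (1 - b) / b := div_pos (Real.Gamma_pos_of_pos (by linarith)) h
    rw [abs_of_neg (by linarith), ← hG, kernelMellin_of_pos h,
      Real.Gamma_eq_integral (by linarith), ← integral_div, ofReal_integral_eq_lintegral_ofReal]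
    · refine setLIntegral_congr_fun measurableSet_Ioi fun v _ ↦ ?_
      rw [show 1 - b - 1 = -b by ring, mul_div_assoc]
    · exact (Real.GammaIntegral_convergent (by linarith : 0 < 1 - b)).div_const b
    · filter_upwards [ae_restrict_mem measurableSet_Ioi] with v hv
      exact div_nonneg (mul_nonneg (Real.exp_pos _).le (Real.rpow_nonneg (le_of_lt hv) _)) h.le

/-- The singularity of `s ^ (-b)` at `0` is not integrable. -/
lemma kernelMellin_eq_top {b : ℝ} (hb : 1 ≤ b) : kernelMellin b = ⊤ := by
  have hb0 : 0 < b := by linarith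
  rw [kernelMellin_of_pos hb0]
  by_contra hne
  have hint : IntegrableOn (fun s : ℝ ↦ Real.exp (-s) * (s ^ (-b) / b)) (Set.Ioi 0) := by
    refine (lintegral_ofReal_ne_top_iff_integrable ?_ ?_).1 hne
    · exact Measurable.aestronglyMeasurable (by fun_prop)
    · filter_upwards [ae_restrict_mem measurableSet_Ioi] with v hv
      exact mul_nonneg (Real.exp_pos _).le
        (div_nonneg (Real.rpow_nonneg (le_of_lt hv) _) hb0.le)
  -- On `(0, 1)` the factor `exp (-s)` is bounded below by `exp (-1)`.
  have h2 : IntegrableOn (fun s : ℝ ↦ s ^ (-b)) (Set.Ioo 0 1) := by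
    refine Integrable.mono' ((hint.mono_set Set.Ioo_subset_Ioi_self).const_mul (b * Real.exp 1))
      (Measurable.aestronglyMeasurable (by fun_prop)) ?_
    filter_upwards [ae_restrict_mem measurableSet_Ioo] with v hv
    have hv0 : 0 ≤ v ^ (-b) := Real.rpow_nonneg hv.1.le _
    rw [Real.norm_of_nonneg hv0]
    have h1 : 1 ≤ Real.exp 1 * Real.exp (-v) := by
      rw [← Real.exp_add]; exact Real.one_le_exp (by linarith [hv.2])
    calc v ^ (-b) ≤ (Real.exp 1 * Real.exp (-v)) * v ^ (-b) := le_mul_of_one_le_left hv0 h1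
      _ = _ := by field_simp
  rw [intervalIntegral.integrableOn_Ioo_rpow_iff one_pos] at h2
  linarith

lemma kernelMellin_ne_zero {b : ℝ} (hb0 : b ≠ 0) : kernelMellin b ≠ 0 := by
  rcases lt_or_ge b 1 with h | h
  · rw [kernelMellin_eq_abs_Gamma h hb0, Ne, ENNReal.ofReal_eq_zero, not_le, abs_pos]
    refine Real.Gamma_ne_zero fun m hm ↦ ?_
    rcases m with _ | m
    · simp at hm; exact hb0 hm
    · push_cast at hm
      have : (0 : ℝ) ≤ m := m.cast_nonneg
      linarith
  · rw [kernelMellin_eq_top h]; simp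

/-- Substituting `v = κ u ^ p` in the Mellin integral. Both sides vanish for `κ = 0 < b`, and both
are infinite for `κ = 0`, `b < 0`. -/
lemma lintegral_expKernel_comp_rpow {b p κ : ℝ} (hb : b ≠ 0) (hp : 0 < p) (hκ : 0 ≤ κ) :
    ∫⁻ u in Set.Ioi (0 : ℝ), expKernel b (κ * u ^ p) * ENNReal.ofReal (u ^ (-b - 1)) =
      ENNReal.ofReal p⁻¹ * ENNReal.ofReal κ ^ (b / p) * kernelMellin (b / p) := by
  have hbp : b / p ≠ 0 := div_ne_zero hb hp.ne'
  rcases hκ.eq_or_lt with rfl | hκ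
  · rcases hb.lt_or_gt with h | h
    · have : b / p < 0 := div_neg_of_neg_of_pos h hp
      have h1 : ∫⁻ u in Set.Ioi (0 : ℝ), ENNReal.ofReal (u ^ (-b - 1)) = ⊤ := by
        by_contra hne
        refine not_integrableOn_Ioi_rpow (-b - 1)
          ((lintegral_ofReal_ne_top_iff_integrable ?_ ?_).1 hne)
        · exact Measurable.aestronglyMeasurable (by fun_prop)
        · filter_upwards [ae_restrict_mem measurableSet_Ioi] with v hv
          exact Real.rpow_nonneg (le_of_lt hv) _
      simp only [expKernel, h, if_true, zero_mul, neg_zero, Real.exp_zero, ENNReal.ofReal_one,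
        one_mul, h1, ENNReal.ofReal_zero, ENNReal.zero_rpow_of_neg this]
      rw [ENNReal.mul_top (by simpa using hp), ENNReal.top_mul (kernelMellin_ne_zero hbp)]
    · simp [expKernel, h.le.not_gt, ENNReal.zero_rpow_of_pos (div_pos h hp)]
  · have himg : (fun u : ℝ ↦ κ * u ^ p) '' Set.Ioi 0 = Set.Ioi 0 := by
      ext v
      simp only [Set.mem_image, Set.mem_Ioi]
      constructor
      · rintro ⟨u, hu, rfl⟩; positivity
      · intro hv
        refine ⟨(v / κ) ^ p⁻¹, by positivity, ?_⟩
        rw [← Real.rpow_mul (by positivity), inv_mul_cancel₀ hp.ne', Real.rpow_one]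
        field_simp
    have hinj : Set.InjOn (fun u : ℝ ↦ κ * u ^ p) (Set.Ioi 0) := by
      intro u hu w hw h
      have hu : 0 < u := hu
      have hw : 0 < w := hw
      exact (Real.rpow_left_inj hu.le hw.le hp.ne').1 (mul_left_cancel₀ hκ.ne' h)
    have hder : ∀ u ∈ Set.Ioi (0 : ℝ), HasDerivWithinAt (fun u : ℝ ↦ κ * u ^ p)
        (κ * (p * u ^ (p - 1))) (Set.Ioi 0) u := fun u hu ↦
      ((Real.hasDerivAt_rpow_const (Or.inl (ne_of_gt hu))).const_mul κ).hasDerivWithinAt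
    have key := lintegral_image_eq_lintegral_abs_deriv_mul measurableSet_Ioi hder hinj
      (fun v ↦ expKernel (b / p) v * ENNReal.ofReal (v ^ (-(b / p) - 1)))
    rw [himg] at key
    rw [kernelMellin, key, ENNReal.ofReal_rpow_of_pos hκ, ← ENNReal.ofReal_mul (by positivity),
      ← lintegral_const_mul' _ _ ENNReal.ofReal_ne_top]
    refine setLIntegral_congr_fun measurableSet_Ioi fun u hu ↦ ?_
    have hu : 0 < u := hu
    rw [expKernel_div b _ hp, mul_left_comm (ENNReal.ofReal |_|), mul_left_comm (ENNReal.ofReal _)]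
    congr 1
    rw [abs_of_pos (by positivity), ← ENNReal.ofReal_mul (by positivity),
      ← ENNReal.ofReal_mul (by positivity)]
    congr 1
    rw [Real.mul_rpow hκ.le (by positivity), ← Real.rpow_mul hu.le]
    have e1 : κ ^ (-(b / p) - 1) = (κ ^ (b / p))⁻¹ * κ⁻¹ := by
      rw [Real.rpow_sub hκ, Real.rpow_neg hκ.le, Real.rpow_one]; rfl
    have e2 : u ^ (-b - 1) = u ^ (p - 1) * u ^ (p * (-(b / p) - 1)) := by
      rw [← Real.rpow_add hu]; congr 1; field_simp; ring
    rw [e1, e2]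
    have : κ ^ (b / p) ≠ 0 := (Real.rpow_pos_of_pos hκ _).ne'
    field_simp

/-! ### Absolute moments of the standard Gaussian law -/

lemma lintegral_comp_abs (f : ℝ → ℝ≥0∞) :
    ∫⁻ x, f |x| = 2 * ∫⁻ x in Set.Ioi (0 : ℝ), f x := by
  have h1 : ∫⁻ x in Set.Ioi (0 : ℝ), f |x| = ∫⁻ x in Set.Ioi (0 : ℝ), f x :=
    setLIntegral_congr_fun measurableSet_Ioi fun x hx ↦ by
      simp only [abs_of_pos (Set.mem_Ioi.1 hx)]
  -- The reflection `x ↦ -x` carries the negative half-line to the positive one.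
  have h2 : ∫⁻ x in Set.Iic (0 : ℝ), f |x| = ∫⁻ x in Set.Ioi (0 : ℝ), f |x| := by
    have := (Measure.measurePreserving_neg (volume : Measure ℝ)).setLIntegral_comp_preimage_emb
      (MeasurableEquiv.neg ℝ).measurableEmbedding (fun x ↦ f |x|) (Set.Ioi 0)
    rw [← this, setLIntegral_congr Iio_ae_eq_Iic.symm]
    simp
  rw [← lintegral_add_compl _ (measurableSet_Ioi (a := (0 : ℝ))), Set.compl_Ioi, h2, h1, two_mul]

lemma lintegral_enorm_rpow_gaussianReal {β : ℝ} (hβ : -1 < β) :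
    ∫⁻ g, ‖g‖ₑ ^ β ∂(gaussianReal 0 1) =
      ENNReal.ofReal (2 ^ (β / 2) * Real.Gamma ((β + 1) / 2) / √Real.pi) := by
  rw [gaussianReal_of_var_ne_zero 0 one_ne_zero, lintegral_withDensity_eq_lintegral_mul _
    (measurable_gaussianPDF 0 1) (by fun_prop)]
  have h1 : ∫⁻ g, (gaussianPDF 0 1 * fun g : ℝ ↦ ‖g‖ₑ ^ β) g =
      2 * ∫⁻ x in Set.Ioi (0 : ℝ),
        ENNReal.ofReal ((√(2 * Real.pi))⁻¹ * Real.exp (-x ^ 2 / 2)) * ENNReal.ofReal x ^ β := by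
    rw [← lintegral_comp_abs fun x ↦
      ENNReal.ofReal ((√(2 * Real.pi))⁻¹ * Real.exp (-x ^ 2 / 2)) * ENNReal.ofReal x ^ β]
    refine lintegral_congr fun g ↦ ?_
    simp [gaussianPDF_def, gaussianPDFReal, Real.enorm_eq_ofReal_abs]
  have h2 : ∀ x ∈ Set.Ioi (0 : ℝ),
      ENNReal.ofReal ((√(2 * Real.pi))⁻¹ * Real.exp (-x ^ 2 / 2)) * ENNReal.ofReal x ^ β =
      ENNReal.ofReal ((√(2 * Real.pi))⁻¹ * (x ^ β * Real.exp (-(1 / 2) * x ^ (2 : ℝ)))) := by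
    intro x hx
    rw [ENNReal.ofReal_rpow_of_pos hx, ← ENNReal.ofReal_mul (by positivity), Real.rpow_two]
    congr 1
    rw [show -x ^ 2 / 2 = -(1 / 2) * x ^ 2 by ring]
    ring
  rw [h1, setLIntegral_congr_fun measurableSet_Ioi h2,
    ← ofReal_integral_eq_lintegral_ofReal, integral_const_mul,
    integral_rpow_mul_exp_neg_mul_rpow two_pos hβ (by norm_num),
    show (2 : ℝ≥0∞) = ENNReal.ofReal 2 by simp, ← ENNReal.ofReal_mul (by norm_num)]
  · congr 1
    have e : (1 / 2 : ℝ) ^ (-(β + 1) / 2) = 2 ^ (β / 2) * √2 := by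
      rw [one_div, Real.inv_rpow two_pos.le, ← Real.rpow_neg two_pos.le, Real.sqrt_eq_rpow,
        ← Real.rpow_add two_pos]
      congr 1; ring
    rw [e, Real.sqrt_mul two_pos.le]
    field_simp
  · exact (integrableOn_rpow_mul_exp_neg_mul_rpow hβ two_pos (by norm_num)).const_mul _
  · filter_upwards [ae_restrict_mem measurableSet_Ioi] with x hx
    have : 0 ≤ x ^ β := Real.rpow_nonneg (le_of_lt hx) _
    simp only [Pi.zero_apply]
    positivity

/-! ### Gaussian mixtures and absolute moments -/

section StableLaw

variable {ν : Measure ℝ} [IsProbabilityMeasure ν] {c α : ℝ}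

/-- `exp (-u x²)` is the characteristic function at `x` of a centred Gaussian variable `√(2u) g`;
exchanging the expectations over `x` and `g` turns the left-hand side into the expectation of the
characteristic function of `ν` at `√(2u) g`. -/
lemma integral_exp_neg_mul_sq_eq
    (hν : ∀ s, charFun ν s = ((Real.exp (-(c * |s| ^ α)) : ℝ) : ℂ)) {u : ℝ} (hu : 0 ≤ u) :
    ∫ x, Real.exp (-(x ^ 2 * u)) ∂ν =
      ∫ g, Real.exp (-(c * |√(2 * u) * g| ^ α)) ∂(gaussianReal 0 1) := by
  have h1 : ∀ x : ℝ, ((Real.exp (-(x ^ 2 * u)) : ℝ) : ℂ) =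
      ∫ g, Complex.exp ((√(2 * u) * g * x : ℝ) * Complex.I) ∂(gaussianReal 0 1) := by
    intro x
    have := charFun_gaussianReal (μ := 0) (v := 1) (√(2 * u) * x)
    rw [charFun_apply_real] at this
    have e : ∀ g : ℝ, Complex.exp ((√(2 * u) * g * x : ℝ) * Complex.I) =
        Complex.exp (((√(2 * u) * x : ℝ) : ℂ) * g * Complex.I) := by
      intro g; congr 1; push_cast; ring
    simp_rw [e]
    rw [this]
    have hs : ((√(2 * u) : ℝ) : ℂ) ^ 2 = 2 * u := by
      rw [← Complex.ofReal_pow, Real.sq_sqrt (by positivity)]; push_cast; ring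
    push_cast
    congr 1
    rw [mul_pow, hs]
    ring
  have h2 : ∀ g : ℝ, ((Real.exp (-(c * |√(2 * u) * g| ^ α)) : ℝ) : ℂ) =
      ∫ x, Complex.exp ((√(2 * u) * g * x : ℝ) * Complex.I) ∂ν := by
    intro g
    rw [← hν, charFun_apply_real]
    push_cast
    rfl
  apply Complex.ofReal_injective
  rw [← integral_complex_ofReal, ← integral_complex_ofReal]
  simp_rw [h1, h2]
  refine integral_integral_swap (Integrable.of_bound (C := 1) ?_ ?_)
  · refine Continuous.aestronglyMeasurable ?_
    unfold Function.uncurry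
    fun_prop
  · exact Eventually.of_forall fun p ↦ (Complex.norm_exp_ofReal_mul_I _).le

/-- The Gaussian mixture identity for `exp (-v)` and, by complementation, for `1 - exp (-v)`. -/
lemma lintegral_expKernel_mul_sq_eq (hc : 0 ≤ c)
    (hν : ∀ s, charFun ν s = ((Real.exp (-(c * |s| ^ α)) : ℝ) : ℂ)) (b : ℝ) {u : ℝ} (hu : 0 ≤ u) :
    ∫⁻ x, expKernel b (x ^ 2 * u) ∂ν =
      ∫⁻ g, expKernel b (c * |√(2 * u) * g| ^ α) ∂(gaussianReal 0 1) := by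
  -- Both sides are expressed by the Bochner integrals compared in `integral_exp_neg_mul_sq_eq`.
  have main : ∀ {m : Measure ℝ} [IsProbabilityMeasure m] {f : ℝ → ℝ}, Measurable f →
      (∀ x, 0 ≤ f x) → ∫⁻ x, expKernel b (f x) ∂m =
        if b < 0 then ENNReal.ofReal (∫ x, Real.exp (-f x) ∂m)
          else ENNReal.ofReal (1 - ∫ x, Real.exp (-f x) ∂m) := by
    intro m _ f hf hf0
    have hint : Integrable (fun x ↦ Real.exp (-f x)) m := by
      refine Integrable.of_bound (C := 1) (by fun_prop) (Eventually.of_forall fun x ↦ ?_)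
      rw [Real.norm_of_nonneg (Real.exp_pos _).le]
      exact Real.exp_le_one_iff.2 (neg_nonpos.2 (hf0 x))
    unfold expKernel
    split_ifs with hb
    · rw [ofReal_integral_eq_lintegral_ofReal hint
        (Eventually.of_forall fun x ↦ (Real.exp_pos _).le)]
    · have : 1 - ∫ x, Real.exp (-f x) ∂m = ∫ x, (1 - Real.exp (-f x)) ∂m := by
        rw [integral_sub (integrable_const _) hint]; simp
      have hint' : Integrable (fun x ↦ 1 - Real.exp (-f x)) m := (integrable_const _).sub hint
      rw [this, ofReal_integral_eq_lintegral_ofReal hint']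
      exact Eventually.of_forall fun x ↦
        sub_nonneg.2 (Real.exp_le_one_iff.2 (neg_nonpos.2 (hf0 x)))
  rw [main (by fun_prop) (fun x ↦ by positivity), main (by fun_prop) (fun x ↦ by positivity),
    integral_exp_neg_mul_sq_eq hν hu]

/-- Integrating `lintegral_expKernel_mul_sq_eq` against `u ^ (-β / 2 - 1) du` gives the absolute
moment of order `β` of `ν`, up to a factor that may be infinite. -/
lemma lintegral_enorm_rpow_mul_kernelMellin (hc : 0 ≤ c) (hα : 0 < α)
    (hν : ∀ s, charFun ν s = ((Real.exp (-(c * |s| ^ α)) : ℝ) : ℂ)) {β : ℝ} (hβ0 : β ≠ 0) :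
    (∫⁻ x, ‖x‖ₑ ^ β ∂ν) * kernelMellin (β / 2) =
      ENNReal.ofReal (2 / α) * (ENNReal.ofReal c ^ (β / α) * ENNReal.ofReal 2 ^ (β / 2)) *
        (∫⁻ g, ‖g‖ₑ ^ β ∂(gaussianReal 0 1)) * kernelMellin (β / α) := by
  have hβ2 : β / 2 ≠ 0 := div_ne_zero hβ0 two_ne_zero
  have hmeas := measurable_expKernel (β / 2)
  have h1 : ∀ x : ℝ, ∫⁻ u in Set.Ioi (0 : ℝ),
      expKernel (β / 2) (x ^ 2 * u) * ENNReal.ofReal (u ^ (-(β / 2) - 1)) =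
        ‖x‖ₑ ^ β * kernelMellin (β / 2) := by
    intro x
    have := lintegral_expKernel_comp_rpow hβ2 one_pos (sq_nonneg x)
    simp only [Real.rpow_one, inv_one, ENNReal.ofReal_one, one_mul, div_one] at this
    rw [this]
    congr 1
    rw [← sq_abs, Real.enorm_eq_ofReal_abs, ENNReal.ofReal_pow (abs_nonneg x), ← ENNReal.rpow_two,
      ← ENNReal.rpow_mul, mul_div_cancel₀ _ two_ne_zero]
  have h2 : ∀ g : ℝ, ∫⁻ u in Set.Ioi (0 : ℝ),
      expKernel (β / 2) (c * |√(2 * u) * g| ^ α) * ENNReal.ofReal (u ^ (-(β / 2) - 1)) =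
        ENNReal.ofReal (2 / α) * (ENNReal.ofReal c ^ (β / α) * ENNReal.ofReal 2 ^ (β / 2)) *
        ‖g‖ₑ ^ β * kernelMellin (β / α) := by
    intro g
    have hκ : 0 ≤ c * (2 ^ (α / 2) * |g| ^ α) := by positivity
    have := lintegral_expKernel_comp_rpow hβ2 (half_pos hα) hκ
    rw [show β / 2 / (α / 2) = β / α by field_simp, inv_div] at this
    have e : ENNReal.ofReal (c * (2 ^ (α / 2) * |g| ^ α)) ^ (β / α) =
        ENNReal.ofReal c ^ (β / α) * ENNReal.ofReal 2 ^ (β / 2) * ‖g‖ₑ ^ β := by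
      rw [ENNReal.ofReal_mul hc, ENNReal.ofReal_mul (by positivity),
        ENNReal.mul_rpow_of_ne_top ENNReal.ofReal_ne_top
          (ENNReal.mul_ne_top ENNReal.ofReal_ne_top ENNReal.ofReal_ne_top),
        ENNReal.mul_rpow_of_ne_top ENNReal.ofReal_ne_top ENNReal.ofReal_ne_top,
        ← ENNReal.ofReal_rpow_of_nonneg two_pos.le (by positivity),
        ← ENNReal.ofReal_rpow_of_nonneg (abs_nonneg g) hα.le, ← ENNReal.rpow_mul,
        ← ENNReal.rpow_mul, ← Real.enorm_eq_ofReal_abs, mul_div_cancel₀ _ hα.ne',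
        show α / 2 * (β / α) = β / 2 by field_simp, mul_assoc]
    rw [e, ← mul_assoc (ENNReal.ofReal (2 / α))] at this
    rw [← this]
    refine setLIntegral_congr_fun measurableSet_Ioi fun u hu ↦ ?_
    have hu : 0 < u := hu
    have : c * |√(2 * u) * g| ^ α = c * (2 ^ (α / 2) * |g| ^ α) * u ^ (α / 2) := by
      rw [abs_mul, abs_of_nonneg (Real.sqrt_nonneg _), Real.mul_rpow (by positivity) (by positivity),
        Real.sqrt_eq_rpow, ← Real.rpow_mul (by positivity), one_div_mul_eq_div,
        Real.mul_rpow two_pos.le hu.le]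
      ring
    simp only [this]
  have h3 : ∀ u ∈ Set.Ioi (0 : ℝ),
      ∫⁻ x, expKernel (β / 2) (x ^ 2 * u) * ENNReal.ofReal (u ^ (-(β / 2) - 1)) ∂ν =
      ∫⁻ g, expKernel (β / 2) (c * |√(2 * u) * g| ^ α) * ENNReal.ofReal (u ^ (-(β / 2) - 1))
        ∂(gaussianReal 0 1) := by
    intro u hu
    rw [lintegral_mul_const' _ _ ENNReal.ofReal_ne_top,
      lintegral_mul_const' _ _ ENNReal.ofReal_ne_top,
      lintegral_expKernel_mul_sq_eq hc hν _ (le_of_lt hu)]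
  calc (∫⁻ x, ‖x‖ₑ ^ β ∂ν) * kernelMellin (β / 2)
      = ∫⁻ x, ‖x‖ₑ ^ β * kernelMellin (β / 2) ∂ν := (lintegral_mul_const _ (by fun_prop)).symm
    _ = ∫⁻ x, (∫⁻ u in Set.Ioi (0 : ℝ),
          expKernel (β / 2) (x ^ 2 * u) * ENNReal.ofReal (u ^ (-(β / 2) - 1))) ∂ν := by
        simp_rw [h1]
    _ = ∫⁻ u in Set.Ioi (0 : ℝ), ∫⁻ x,
          expKernel (β / 2) (x ^ 2 * u) * ENNReal.ofReal (u ^ (-(β / 2) - 1)) ∂ν :=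
        lintegral_lintegral_swap (by unfold Function.uncurry; fun_prop)
    _ = ∫⁻ u in Set.Ioi (0 : ℝ), ∫⁻ g,
          expKernel (β / 2) (c * |√(2 * u) * g| ^ α) * ENNReal.ofReal (u ^ (-(β / 2) - 1))
            ∂(gaussianReal 0 1) := setLIntegral_congr_fun measurableSet_Ioi h3
    _ = ∫⁻ g, (∫⁻ u in Set.Ioi (0 : ℝ),
          expKernel (β / 2) (c * |√(2 * u) * g| ^ α) * ENNReal.ofReal (u ^ (-(β / 2) - 1)))
            ∂(gaussianReal 0 1) :=
        lintegral_lintegral_swap (by unfold Function.uncurry; fun_prop)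
    _ = _ := by
        simp_rw [h2]
        rw [lintegral_mul_const _ (by fun_prop), lintegral_const_mul _ (by fun_prop)]

end StableLaw

/-! ### Moments of laws with characteristic function `exp (-c |s| ^ α)` -/

/-- The two Gamma values have the sign of `-β`. -/
lemma Gamma_div_Gamma_nonneg {α β : ℝ} (hα : 0 < α) (hβ0 : β ≠ 0) (hβα : β < α) (hβ2 : β < 2) :
    0 ≤ Real.Gamma (-β / α) / Real.Gamma (-β / 2) := by
  rcases hβ0.lt_or_gt with h | h
  · exact div_nonneg (Real.Gamma_pos_of_pos (div_pos (by linarith) hα)).le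
      (Real.Gamma_pos_of_pos (by linarith)).le
  · have hneg : ∀ x : ℝ, 0 < x → x < 1 → Real.Gamma (-x) ≤ 0 := by
      intro x hx hx1
      have h1 := Real.Gamma_add_one (s := -x) (by linarith)
      have h2 : 0 < Real.Gamma (-x + 1) := Real.Gamma_pos_of_pos (by linarith)
      rw [h1] at h2
      exact (neg_of_mul_pos_right h2 (by linarith)).le
    rw [neg_div, neg_div]
    exact div_nonneg_of_nonpos (hneg _ (by positivity) ((div_lt_one hα).2 hβα))
      (hneg _ (by positivity) (by linarith))

lemma fracMomentConst_nonneg {α β : ℝ} (hα : 0 < α) (hβ0 : β ≠ 0) (hβ : -1 < β) (hβα : β < α)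
    (hβ2 : β < 2) : 0 ≤ fracMomentConst β α := by
  have h1 := Gamma_div_Gamma_nonneg hα hβ0 hβα hβ2
  have h2 : 0 < Real.Gamma ((β + 1) / 2) := Real.Gamma_pos_of_pos (by linarith)
  exact mul_nonneg (by positivity) h1

/-- The absolute moment of order `β` of the standard Gaussian law, as given by
`lintegral_enorm_rpow_gaussianReal`, is positive. -/
lemma two_rpow_mul_Gamma_div_sqrt_pi_pos {β : ℝ} (hβ : -1 < β) :
    0 < 2 ^ (β / 2) * Real.Gamma ((β + 1) / 2) / √Real.pi := by
  have : 0 < Real.Gamma ((β + 1) / 2) := Real.Gamma_pos_of_pos (by linarith)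
  positivity

lemma aestronglyMeasurable_ofReal_cpow (β : ℝ) (m : Measure ℝ) :
    AEStronglyMeasurable (fun x : ℝ ↦ (x : ℂ) ^ (β : ℂ)) m :=
  Measurable.aestronglyMeasurable (by fun_prop)

lemma enorm_ofReal_cpow (x β : ℝ) (h : x ≠ 0 ∨ 0 ≤ β) :
    ‖(x : ℂ) ^ (β : ℂ)‖ₑ = ‖x‖ₑ ^ β := by
  rw [← ofReal_norm, Complex.norm_cpow_real, Complex.norm_real, ← ofReal_norm]
  rcases h with h | h
  · rw [ENNReal.ofReal_rpow_of_pos (norm_pos_iff.2 h)]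
  · rw [ENNReal.ofReal_rpow_of_nonneg (norm_nonneg x) h]

/-- Values at `x` and `-x` of the principal power add up to `|x| ^ β (1 + exp (i π β))`. -/
lemma ofReal_cpow_add_neg {β : ℝ} (hβ : β ≠ 0) (x : ℝ) :
    (x : ℂ) ^ (β : ℂ) + ((-x : ℝ) : ℂ) ^ (β : ℂ) =
      2 * ((Real.cos (Real.pi * β / 2) : ℂ) *
        Complex.exp (Complex.I * ((β * Real.pi / 2 : ℝ) : ℂ))) * ((|x| ^ β : ℝ) : ℂ) := by
  have hpos : ∀ y : ℝ, 0 < y → (y : ℂ) ^ (β : ℂ) + ((-y : ℝ) : ℂ) ^ (β : ℂ) =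
      2 * ((Real.cos (Real.pi * β / 2) : ℂ) *
        Complex.exp (Complex.I * ((β * Real.pi / 2 : ℝ) : ℂ))) * ((y ^ β : ℝ) : ℂ) := by
    intro y hy
    rw [Complex.ofReal_cpow_of_nonpos (by linarith : -y ≤ 0), Complex.ofReal_neg, neg_neg,
      ← Complex.ofReal_cpow hy.le]
    have h2 : 2 * (Real.cos (Real.pi * β / 2) : ℂ) =
        Complex.exp (Complex.I * ((β * Real.pi / 2 : ℝ) : ℂ)) +
          Complex.exp (-(Complex.I * ((β * Real.pi / 2 : ℝ) : ℂ))) := by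
      rw [Complex.ofReal_cos, Complex.two_cos]
      push_cast
      congr 2 <;> ring
    rw [← mul_assoc, h2, add_mul, ← Complex.exp_add, ← Complex.exp_add, neg_add_cancel,
      Complex.exp_zero]
    have : Complex.I * ((β * Real.pi / 2 : ℝ) : ℂ) + Complex.I * ((β * Real.pi / 2 : ℝ) : ℂ) =
        Real.pi * Complex.I * β := by push_cast; ring
    rw [this]
    ring
  rcases lt_trichotomy x 0 with h | rfl | h
  · rw [add_comm, abs_of_neg h]
    simpa using hpos (-x) (neg_pos.2 h)
  · simp [hβ]
  · rw [abs_of_pos h]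
    exact hpos x h

/-- Averaging over `x` and `-x` expresses the moment of the principal power by the absolute moment. -/
lemma integral_ofReal_cpow_of_symm {ν : Measure ℝ} (hsymm : ν.map (fun x ↦ -x) = ν) {β : ℝ} (hβ : β ≠ 0)
    (hint : Integrable (fun x : ℝ ↦ (x : ℂ) ^ (β : ℂ)) ν) :
    ∫ x, (x : ℂ) ^ (β : ℂ) ∂ν =
      ((Real.cos (Real.pi * β / 2) : ℂ) *
        Complex.exp (Complex.I * ((β * Real.pi / 2 : ℝ) : ℂ))) *
        ((∫ x, |x| ^ β ∂ν : ℝ) : ℂ) := by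
  have h1 : ∫ x, (x : ℂ) ^ (β : ℂ) ∂ν = ∫ x, ((-x : ℝ) : ℂ) ^ (β : ℂ) ∂ν := by
    conv_lhs => rw [← hsymm]
    rw [integral_map (by fun_prop) (aestronglyMeasurable_ofReal_cpow β _)]
  have hint' : Integrable (fun x : ℝ ↦ ((-x : ℝ) : ℂ) ^ (β : ℂ)) ν := by
    have := hint
    rw [← hsymm, integrable_map_measure (aestronglyMeasurable_ofReal_cpow β _) (by fun_prop)]
      at this
    exact this
  have h2 : 2 * ∫ x, (x : ℂ) ^ (β : ℂ) ∂ν =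
      2 * (((Real.cos (Real.pi * β / 2) : ℂ) *
        Complex.exp (Complex.I * ((β * Real.pi / 2 : ℝ) : ℂ))) *
        ((∫ x, |x| ^ β ∂ν : ℝ) : ℂ)) := by
    rw [two_mul]
    nth_rewrite 2 [h1]
    rw [← integral_add hint hint', ← integral_complex_ofReal, ← mul_assoc, ← integral_const_mul]
    simp_rw [ofReal_cpow_add_neg hβ]
  exact mul_left_cancel₀ two_ne_zero h2

section StableLaw

variable {ν : Measure ℝ} [IsProbabilityMeasure ν] {c α : ℝ}

/-- For `β < 2` the two Mellin factors are finite, and their quotient is the quotient of Gamma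
values in `fracMomentConst`. -/
lemma lintegral_enorm_rpow_eq (hc : 0 ≤ c) (hα : 0 < α)
    (hν : ∀ s, charFun ν s = ((Real.exp (-(c * |s| ^ α)) : ℝ) : ℂ)) {β : ℝ} (hβ0 : β ≠ 0)
    (hβ : -1 < β) (hβα : β < α) (hβ2 : β < 2) (hcβ : β < 0 → c ≠ 0) :
    ∫⁻ x, ‖x‖ₑ ^ β ∂ν = ENNReal.ofReal (fracMomentConst β α * c ^ (β / α)) := by
  have key := lintegral_enorm_rpow_mul_kernelMellin hc hα hν hβ0
  have e1 : β / α < 1 := (div_lt_one hα).2 hβα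
  have hcpow : ENNReal.ofReal c ^ (β / α) = ENNReal.ofReal (c ^ (β / α)) := by
    rcases hβ0.lt_or_gt with h | h
    · exact ENNReal.ofReal_rpow_of_pos (lt_of_le_of_ne hc (Ne.symm (hcβ h)))
    · exact ENNReal.ofReal_rpow_of_nonneg hc (by positivity)
  have hG2 : kernelMellin (β / 2) ≠ 0 := kernelMellin_ne_zero (div_ne_zero hβ0 two_ne_zero)
  rw [kernelMellin_eq_abs_Gamma (by linarith) (div_ne_zero hβ0 two_ne_zero)] at key hG2
  rw [kernelMellin_eq_abs_Gamma e1 (div_ne_zero hβ0 hα.ne'), lintegral_enorm_rpow_gaussianReal hβ,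
    hcpow, ENNReal.ofReal_rpow_of_pos two_pos] at key
  have hG2' : 0 < |Real.Gamma (-(β / 2))| := abs_pos.2 (by simpa using hG2)
  have hm := two_rpow_mul_Gamma_div_sqrt_pi_pos hβ
  have hcp : 0 ≤ c ^ (β / α) := Real.rpow_nonneg hc _
  rw [← ENNReal.ofReal_mul hcp, ← ENNReal.ofReal_mul (by positivity),
    ← ENNReal.ofReal_mul (by positivity), ← ENNReal.ofReal_mul (by positivity)] at key
  rw [(ENNReal.eq_div_iff hG2 ENNReal.ofReal_ne_top).2 ((mul_comm _ _).trans key),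
    ← ENNReal.ofReal_div_of_pos hG2']
  congr 1
  have hratio : |Real.Gamma (-(β / α))| / |Real.Gamma (-(β / 2))| =
      Real.Gamma (-β / α) / Real.Gamma (-β / 2) := by
    rw [← abs_div, ← neg_div, ← neg_div, abs_of_nonneg]
    exact Gamma_div_Gamma_nonneg hα hβ0 hβα hβ2
  have h2 : (2 : ℝ) ^ (β + 1) = 2 * 2 ^ (β / 2) * 2 ^ (β / 2) := by
    rw [mul_assoc, ← Real.rpow_add two_pos, Real.rpow_add two_pos, Real.rpow_one, add_halves,
      mul_comm]
  rw [mul_div_assoc, hratio, fracMomentConst, h2]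
  field_simp

/-- A law with characteristic function `exp (-c |s| ^ α)` and a moment of order `β ∈ [2, α)` is
degenerate. -/
lemma ae_eq_zero_of_two_le (hc : 0 ≤ c) (hα : 0 < α)
    (hν : ∀ s, charFun ν s = ((Real.exp (-(c * |s| ^ α)) : ℝ) : ℂ)) {β : ℝ}
    (hβα : β < α) (hβ2 : 2 ≤ β) : ∀ᵐ x ∂ν, x = 0 := by
  have hβ0 : 0 < β := by linarith
  have key := lintegral_enorm_rpow_mul_kernelMellin hc hα hν hβ0.ne'
  rw [kernelMellin_eq_top (by linarith : 1 ≤ β / 2), kernelMellin_eq_abs_Gamma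
    ((div_lt_one hα).2 hβα) (div_ne_zero hβ0.ne' hα.ne'),
    lintegral_enorm_rpow_gaussianReal (by linarith),
    ENNReal.ofReal_rpow_of_nonneg hc (by positivity), ENNReal.ofReal_rpow_of_pos two_pos] at key
  have h0 : ∫⁻ x, ‖x‖ₑ ^ β ∂ν = 0 := by
    by_contra hne
    rw [ENNReal.mul_top hne] at key
    exact absurd key.symm (by finiteness)
  rw [lintegral_eq_zero_iff (by fun_prop)] at h0
  filter_upwards [h0] with x hx
  simpa [ENNReal.rpow_eq_zero_iff, hβ0, hβ0.not_gt] using hx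

lemma eq_zero_of_ae_eq_zero (h : ∀ᵐ x ∂ν, x = 0)
    (hν : ∀ s, charFun ν s = ((Real.exp (-(c * |s| ^ α)) : ℝ) : ℂ)) : c = 0 := by
  have h1 : charFun ν 1 = 1 := by
    rw [charFun_apply_real, integral_congr_ae (g := fun _ ↦ 1)]
    · simp
    · filter_upwards [h] with x hx
      simp [hx]
  rw [hν 1, Complex.ofReal_eq_one] at h1
  simpa using h1

/-- In the non-Gaussian case the moment of order `α` is infinite, since the Mellin factor is
infinite at `1` but finite at `α / 2`. -/
lemma lintegral_enorm_rpow_self_eq_top (hc : 0 < c) (hα : 0 < α) (hα2 : α < 2)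
    (hν : ∀ s, charFun ν s = ((Real.exp (-(c * |s| ^ α)) : ℝ) : ℂ)) :
    ∫⁻ x, ‖x‖ₑ ^ α ∂ν = ⊤ := by
  have key := lintegral_enorm_rpow_mul_kernelMellin hc.le hα hν hα.ne'
  rw [kernelMellin_eq_abs_Gamma (by linarith) (div_ne_zero hα.ne' two_ne_zero), div_self hα.ne',
    kernelMellin_eq_top le_rfl, lintegral_enorm_rpow_gaussianReal (by linarith), ENNReal.rpow_one,
    ENNReal.ofReal_rpow_of_pos two_pos] at key
  have hm := two_rpow_mul_Gamma_div_sqrt_pi_pos (by linarith : -1 < α)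
  rw [ENNReal.mul_top] at key
  · by_contra hne
    exact absurd key (ENNReal.mul_ne_top hne ENNReal.ofReal_ne_top)
  · simp only [ne_eq, mul_eq_zero, ENNReal.ofReal_eq_zero, not_or, not_le]
    exact ⟨⟨by positivity, hc, by positivity⟩, hm⟩

/-- The law is symmetric, its characteristic function being even. -/
lemma map_neg_eq_self
    (hν : ∀ s, charFun ν s = ((Real.exp (-(c * |s| ^ α)) : ℝ) : ℂ)) :
    ν.map (fun x ↦ -x) = ν := by
  have := Measure.isProbabilityMeasure_map (μ := ν) (f := fun x : ℝ ↦ -x) (by fun_prop)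
  refine Measure.ext_of_charFun (funext fun s ↦ ?_)
  have h := charFun_map_mul (μ := ν) (-1) s
  simp only [neg_one_mul] at h
  rw [h, hν, hν, abs_neg]

/-- Existence and value of the moments of order `β ∈ (-1, α)`, `β ≠ 0`. -/
lemma integrable_and_integral_ofReal_cpow (hc : 0 ≤ c) (hα : 0 < α)
    (hν : ∀ s, charFun ν s = ((Real.exp (-(c * |s| ^ α)) : ℝ) : ℂ)) {β : ℝ} (hβ0 : β ≠ 0)
    (hβ : -1 < β) (hβα : β < α) (hcβ : β < 0 → c ≠ 0) :
    Integrable (fun x : ℝ ↦ (x : ℂ) ^ (β : ℂ)) ν ∧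
      ∫ x, (x : ℂ) ^ (β : ℂ) ∂ν =
        ((Real.cos (Real.pi * β / 2) : ℂ) *
          Complex.exp (Complex.I * ((β * Real.pi / 2 : ℝ) : ℂ))) *
          ((fracMomentConst β α * c ^ (β / α) : ℝ) : ℂ) := by
  rcases lt_or_ge β 2 with hβ2 | hβ2
  · have hL := lintegral_enorm_rpow_eq hc hα hν hβ0 hβ hβα hβ2 hcβ
    have hfin : ∫⁻ x, ‖x‖ₑ ^ β ∂ν ≠ ⊤ := hL ▸ ENNReal.ofReal_ne_top
    -- For `β < 0` the power of `0` is `∞` in `[0, ∞]` but `0` in `ℂ`; finiteness of the moment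
    -- excludes an atom at `0`, so the two notions agree almost everywhere.
    have hne : ∀ᵐ x ∂ν, x ≠ 0 ∨ 0 ≤ β := by
      filter_upwards [ae_lt_top (by fun_prop) hfin] with x hx
      by_contra! h
      rw [h.1, enorm_zero, ENNReal.zero_rpow_of_neg h.2] at hx
      exact hx.ne rfl
    have hint : Integrable (fun x : ℝ ↦ (x : ℂ) ^ (β : ℂ)) ν := by
      refine ⟨aestronglyMeasurable_ofReal_cpow β ν, ?_⟩
      rw [HasFiniteIntegral, lintegral_congr_ae (g := fun x ↦ ‖x‖ₑ ^ β)]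
      · exact hfin.lt_top
      · filter_upwards [hne] with x hx using enorm_ofReal_cpow x β hx
    refine ⟨hint, ?_⟩
    rw [integral_ofReal_cpow_of_symm (map_neg_eq_self hν) hβ0 hint]
    congr 2
    have hae : ∀ᵐ x ∂ν, ENNReal.ofReal (|x| ^ β) = ‖x‖ₑ ^ β := by
      filter_upwards [hne] with x hx
      rw [← enorm_ofReal_cpow x β hx, ← ofReal_norm, Complex.norm_cpow_real,
        Complex.norm_real, Real.norm_eq_abs]
    have hpos : 0 ≤ fracMomentConst β α * c ^ (β / α) :=
      mul_nonneg (fracMomentConst_nonneg hα hβ0 hβ hβα hβ2) (Real.rpow_nonneg hc _)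
    rw [integral_eq_lintegral_of_nonneg_ae (Eventually.of_forall fun x ↦ by positivity)
      (Measurable.aestronglyMeasurable (by fun_prop)), lintegral_congr_ae hae, hL,
      ENNReal.toReal_ofReal hpos]
  · have hz := ae_eq_zero_of_two_le hc hα hν hβα hβ2
    -- The law is the Dirac mass at `0`, and the formula holds because `c = 0`.
    have hc0 := eq_zero_of_ae_eq_zero hz hν
    have hae : (fun x : ℝ ↦ (x : ℂ) ^ (β : ℂ)) =ᵐ[ν] fun _ ↦ 0 := by
      filter_upwards [hz] with x hx
      simp [hx, hβ0]
    refine ⟨(integrable_congr hae).2 (integrable_const _), ?_⟩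
    rw [integral_congr_ae hae, hc0, Real.zero_rpow (div_ne_zero hβ0 hα.ne')]
    simp

/-- Moments of order `β ≥ α` do not exist, since `|x| ^ α ≤ 1 + |x| ^ β`. -/
lemma not_integrable_ofReal_cpow (hc : 0 < c) (hα : 0 < α) (hα2 : α < 2)
    (hν : ∀ s, charFun ν s = ((Real.exp (-(c * |s| ^ α)) : ℝ) : ℂ)) {β : ℝ} (hβ : α ≤ β) :
    ¬ Integrable (fun x : ℝ ↦ (x : ℂ) ^ (β : ℂ)) ν := by
  intro hint
  have hβ0 : 0 ≤ β := by linarith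
  have hfin : ∫⁻ x, ‖x‖ₑ ^ β ∂ν < ⊤ := by
    simpa only [HasFiniteIntegral, enorm_ofReal_cpow _ β (Or.inr hβ0)] using hint.2
  have hle : ∫⁻ x, ‖x‖ₑ ^ α ∂ν ≤ ∫⁻ x, (1 + ‖x‖ₑ ^ β) ∂ν := by
    refine lintegral_mono fun x ↦ ?_
    rcases le_total ‖x‖ₑ 1 with h | h
    · exact (ENNReal.rpow_le_one h hα.le).trans le_self_add
    · exact (ENNReal.rpow_le_rpow_of_exponent_le h hβ).trans le_add_self
  rw [lintegral_enorm_rpow_self_eq_top hc hα hα2 hν, lintegral_add_left (by fun_prop)] at hle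
  simp only [lintegral_const, measure_univ, mul_one, top_le_iff, ENNReal.add_eq_top,
    ENNReal.one_ne_top, false_or] at hle
  exact hfin.ne hle

end StableLaw

/-! ### Self-similarity of the limits -/

lemma realMatrixPow_smul_one {D : ℕ} {r : ℝ} (hr : 0 < r) (a : ℝ) :
    realMatrixPow r (a • (1 : Matrix (Fin D) (Fin D) ℝ)) =
      (r ^ a) • (1 : Matrix (Fin D) (Fin D) ℝ) := by
  rw [realMatrixPow, smul_smul, ← Matrix.diagonal_one, ← Matrix.diagonal_smul,
    Matrix.exp_diagonal, ← Matrix.diagonal_smul]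
  congr 1
  ext i
  simp [Pi.coe_exp, ← Real.exp_eq_exp_ℝ, Real.rpow_def_of_pos hr]

namespace IsStrictlyOperatorStableLimit

variable {D : ℕ} {Ω Ω' : Type*} [MeasurableSpace Ω] [MeasurableSpace Ω']
    {P : Measure Ω} [IsProbabilityMeasure P] {P' : Measure Ω'} [IsProbabilityMeasure P']
    {α : ℝ} {L : ℝ → Ω → EuclideanSpace ℝ (Fin D)} {X : ℕ → Ω' → EuclideanSpace ℝ (Fin D)}

/-- For `E = α⁻¹ I` the normalized sums are `n ^ (-1 / α) ∑_{i < ⌊n t⌋} X i`. -/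
lemma normalized_sum_eq {n : ℕ} (hn : 0 < n) (v : EuclideanSpace ℝ (Fin D)) :
    Matrix.toEuclideanCLM (𝕜 := ℝ)
      (realMatrixPow (n : ℝ) (-(α⁻¹ • (1 : Matrix (Fin D) (Fin D) ℝ)))) v =
      ((n : ℝ) ^ (-α⁻¹)) • v := by
  rw [← neg_smul, realMatrixPow_smul_one (by exact_mod_cast hn), map_smul, map_one]
  rfl

lemma aemeasurable (hL : IsStrictlyOperatorStableLimit P P'
      (α⁻¹ • (1 : Matrix (Fin D) (Fin D) ℝ)) L X) (i : ℕ) : AEMeasurable (X i) P' :=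
  (hL.identDistrib i).aemeasurable_fst

lemma tendsto_smul_sum (hL : IsStrictlyOperatorStableLimit P P'
      (α⁻¹ • (1 : Matrix (Fin D) (Fin D) ℝ)) L X) {t : ℝ} (ht : 0 < t) :
    TendstoInDistribution
      (fun (n : ℕ) ω ↦ ((n : ℝ) ^ (-α⁻¹)) • ∑ i ∈ Finset.range ⌊(n : ℝ) * t⌋₊, X i ω)
      atTop (L t) (fun _ ↦ P') P := by
  have hX := hL.aemeasurable
  have h := hL.tendsto t ht
  refine ⟨fun n ↦ by fun_prop, h.aemeasurable_limit, h.tendsto.congr' ?_⟩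
  -- At `n = 0` the two normalizations differ, since `log 0 = 0` turns the matrix power into the
  -- identity.
  filter_upwards [eventually_gt_atTop 0] with n hn
  ext1
  simp only [normalized_sum_eq hn]

/-- Comparing the normalizations at `n` and at `⌊n t⌋` by Slutsky's theorem gives the
self-similarity `L t = t ^ (1 / α) L 1` in law. -/
lemma map_eq_map_smul (hL : IsStrictlyOperatorStableLimit P P'
      (α⁻¹ • (1 : Matrix (Fin D) (Fin D) ℝ)) L X) {t : ℝ} (ht : 0 < t) :
    P.map (L t) = P.map (fun ω ↦ t ^ α⁻¹ • L 1 ω) := by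
  have hX := hL.aemeasurable
  have h1 := hL.tendsto_smul_sum one_pos
  have hfl : Tendsto (fun n : ℕ ↦ ⌊(n : ℝ) * t⌋₊) atTop atTop := by
    simpa only [mul_comm, Function.comp_def] using
      tendsto_nat_floor_mul_atTop t ht
  -- The convergence at time `1` along the subsequence `⌊n t⌋`.
  have h2 : TendstoInDistribution
      (fun (n : ℕ) ω ↦ ((⌊(n : ℝ) * t⌋₊ : ℝ) ^ (-α⁻¹)) •
        ∑ i ∈ Finset.range ⌊((⌊(n : ℝ) * t⌋₊ : ℕ) : ℝ) * 1⌋₊, X i ω)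
      atTop (L 1) (fun _ ↦ P') P :=
    ⟨fun n ↦ by fun_prop, h1.aemeasurable_limit, h1.tendsto.comp hfl⟩
  have hratio : Tendsto (fun n : ℕ ↦ ((⌊(n : ℝ) * t⌋₊ : ℝ) / n) ^ α⁻¹) atTop
      (𝓝 (t ^ α⁻¹)) := by
    have := (tendsto_nat_floor_mul_div_atTop ht.le).comp (tendsto_natCast_atTop_atTop (R := ℝ))
    simp only [mul_comm t, Function.comp_def] at this
    exact this.rpow_const (Or.inl ht.ne')
  have h3 := h2.continuous_comp_prodMk_of_tendstoInMeasure_const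
    (Y := fun (n : ℕ) (_ : Ω') ↦ ((⌊(n : ℝ) * t⌋₊ : ℝ) / n) ^ α⁻¹)
    (g := fun q : EuclideanSpace ℝ (Fin D) × ℝ ↦ q.2 • q.1) (by fun_prop)
    (tendstoInMeasure_of_tendsto_ae (fun n ↦ by fun_prop) (Eventually.of_forall fun _ ↦ hratio))
    (fun n ↦ by fun_prop)
  refine tendstoInDistribution_unique _ (hL.tendsto_smul_sum ht)
    ⟨(hL.tendsto_smul_sum ht).forall_aemeasurable, h3.aemeasurable_limit, h3.tendsto.congr' ?_⟩
  filter_upwards [eventually_gt_atTop 0, hfl.eventually_gt_atTop 0] with n hn hfn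
  refine Subtype.ext (congrArg (fun f ↦ P'.map f) (funext fun ω ↦ ?_))
  simp only [mul_one, Nat.floor_natCast, smul_smul]
  congr 1
  have hn' : (0 : ℝ) < n := by exact_mod_cast hn
  have hf' : (0 : ℝ) < (⌊(n : ℝ) * t⌋₊ : ℝ) := by exact_mod_cast hfn
  rw [Real.div_rpow hf'.le hn'.le, Real.rpow_neg hf'.le, Real.rpow_neg hn'.le]
  have := (Real.rpow_pos_of_pos hf' α⁻¹).ne'
  field_simp

/-- The modulus of the characteristic function of `n ^ (-1 / α) ∑_{i < ⌊n t⌋} X i` is a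
`⌊n t⌋`-th power, hence asymptotically the `t`-th power of its value for `t = 1`. -/
lemma norm_charFun_eq_rpow (hL : IsStrictlyOperatorStableLimit P P'
      (α⁻¹ • (1 : Matrix (Fin D) (Fin D) ℝ)) L X) {t : ℝ} (ht : 0 < t)
    (k : EuclideanSpace ℝ (Fin D)) :
    ‖charFun (P.map (L t)) k‖ = ‖charFun (P.map (L 1)) k‖ ^ t := by
  have hX := hL.aemeasurable
  -- Convergence in distribution in terms of characteristic functions, which are powers here.
  have key : ∀ {s : ℝ}, 0 < s → Tendsto
      (fun n : ℕ ↦ ‖charFun (P'.map (X 0)) ((n : ℝ) ^ (-α⁻¹) • k)‖ ^ ⌊(n : ℝ) * s⌋₊) atTop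
      (𝓝 ‖charFun (P.map (L s)) k‖) := by
    intro s hs
    have h := (ProbabilityMeasure.tendsto_iff_tendsto_charFun.1
      (hL.tendsto_smul_sum hs).tendsto k).norm
    refine h.congr fun n ↦ ?_
    simp only [ProbabilityMeasure.coe_mk]
    rw [charFun_map_smul_comp (by fun_prop), iIndepFun.charFun_map_fun_finsetSum_eq_prod
      (fun i _ ↦ hX i) (iIndepFun.precomp (g := Subtype.val) Subtype.val_injective hL.indep), Finset.prod_apply,
      Finset.prod_congr rfl fun i _ ↦ by rw [(hL.identDistrib i).map_eq], Finset.prod_const,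
      Finset.card_range, norm_pow]
  have hratio : Tendsto (fun n : ℕ ↦ (⌊(n : ℝ) * t⌋₊ : ℝ) / n) atTop (𝓝 t) := by
    have := (tendsto_nat_floor_mul_div_atTop ht.le).comp (tendsto_natCast_atTop_atTop (R := ℝ))
    simpa only [mul_comm t, Function.comp_def] using this
  refine tendsto_nhds_unique (key ht) (((key one_pos).rpow hratio (Or.inr ht)).congr' ?_)
  filter_upwards [eventually_gt_atTop 0] with n hn
  have hn' : (n : ℝ) ≠ 0 := by exact_mod_cast hn.ne'
  rw [mul_one, Nat.floor_natCast, ← Real.rpow_natCast, ← Real.rpow_mul (norm_nonneg _),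
    mul_div_cancel₀ _ hn', Real.rpow_natCast]

end IsStrictlyOperatorStableLimit

/-! ### Real-valuedness and homogeneity of the exponent -/

namespace IsNegLogCharFun

variable {D : ℕ} {φ : EuclideanSpace ℝ (Fin D) → ℂ} {ν : Measure (EuclideanSpace ℝ (Fin D))}

/-- Evenness makes the characteristic function real, so `im φ` takes values in `π ℤ`; being
continuous and `0` at the origin, it vanishes. -/
lemma im_eq_zero (hφ : IsNegLogCharFun φ ν) (heven : ∀ k, φ k = φ (-k))
    (k : EuclideanSpace ℝ (Fin D)) : (φ k).im = 0 := by
  have hint : ∀ k, ∃ n : ℤ, (φ k).im = n * Real.pi := by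
    intro k
    have h := charFun_neg (μ := ν) k
    rw [hφ.charFun_eq, hφ.charFun_eq, ← heven, ← Complex.exp_conj,
      Complex.exp_eq_exp_iff_exists_int] at h
    obtain ⟨n, hn⟩ := h
    refine ⟨-n, ?_⟩
    have := congrArg Complex.im hn
    simp at this
    push_cast
    linarith
  by_contra hne
  obtain ⟨n, hn⟩ := hint k
  have hn0 : n ≠ 0 := by rintro rfl; simp at hn; exact hne hn
  have hcont : Continuous fun k ↦ |(φ k).im| := by
    have := hφ.continuous
    fun_prop
  -- A nonzero value would have modulus at least `π`, so `|im φ|` would also take the value `π / 2`.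
  obtain ⟨k', hk'⟩ := mem_range_of_exists_le_of_exists_ge (c := Real.pi / 2) hcont
    ⟨0, by
      simp only [hφ.map_zero, Complex.zero_im, abs_zero]
      positivity⟩ ⟨k, by
      have : (1 : ℝ) ≤ |(n : ℝ)| := by exact_mod_cast Int.one_le_abs hn0
      simp only [hn, abs_mul, abs_of_pos Real.pi_pos]
      nlinarith [Real.pi_pos]⟩
  obtain ⟨m, hm⟩ := hint k'
  simp only [hm, abs_mul, abs_of_pos Real.pi_pos] at hk'
  have h2 : 2 * |(m : ℝ)| = 1 := by
    have := Real.pi_ne_zero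
    field_simp at hk'
    linarith
  have : 2 * |m| = 1 := by exact_mod_cast h2
  omega

lemma eq_ofReal_re (hφ : IsNegLogCharFun φ ν) (heven : ∀ k, φ k = φ (-k))
    (k : EuclideanSpace ℝ (Fin D)) : φ k = ((φ k).re : ℂ) :=
  Complex.ext rfl (by simpa using hφ.im_eq_zero heven k)

lemma re_nonneg [IsProbabilityMeasure ν] (hφ : IsNegLogCharFun φ ν)
    (k : EuclideanSpace ℝ (Fin D)) : 0 ≤ (φ k).re := by
  have := norm_charFun_le_one (μ := ν) (t := k)
  rw [hφ.charFun_eq, Complex.norm_exp] at this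
  simpa using this

end IsNegLogCharFun

section Projection

variable {D : ℕ} {Ω Ω' : Type*} [MeasurableSpace Ω] [MeasurableSpace Ω']
    {P : Measure Ω} [IsProbabilityMeasure P] {P' : Measure Ω'} [IsProbabilityMeasure P']
    {α : ℝ} {L : ℝ → Ω → EuclideanSpace ℝ (Fin D)} {X : ℕ → Ω' → EuclideanSpace ℝ (Fin D)}
    {φ : EuclideanSpace ℝ (Fin D) → ℂ}

/-- Homogeneity of `φ`, from the two expressions for the modulus of the characteristic function
of `L r`. -/
lemma re_negLogCharFun_smul (hα : 0 < α) (hL : IsStrictlyOperatorStableLimit P P'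
      (α⁻¹ • (1 : Matrix (Fin D) (Fin D) ℝ)) L X) (hφ : IsNegLogCharFun φ (P.map (L 1)))
    {r : ℝ} (hr : 0 < r) (k : EuclideanSpace ℝ (Fin D)) :
    (φ (r • k)).re = r ^ α * (φ k).re := by
  have hm : AEMeasurable (L 1) P := (hL.tendsto 1 one_pos).aemeasurable_limit
  have hrα : 0 < r ^ α := Real.rpow_pos_of_pos hr α
  have h := hL.norm_charFun_eq_rpow hrα k
  rw [hL.map_eq_map_smul hrα, charFun_map_smul_comp hm, hφ.charFun_eq, hφ.charFun_eq,
    Complex.norm_exp, Complex.norm_exp, ← Real.exp_mul, Real.exp_eq_exp, ← Real.rpow_mul hr.le,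
    mul_inv_cancel₀ hα.ne', Real.rpow_one] at h
  simp only [Complex.neg_re] at h
  linarith

/-- The projection `⟪σ, L t⟫` has characteristic function `exp (-c |s| ^ α)`. -/
lemma charFun_map_inner (hα : 0 < α) (hL : IsStrictlyOperatorStableLimit P P'
      (α⁻¹ • (1 : Matrix (Fin D) (Fin D) ℝ)) L X) (hφ : IsNegLogCharFun φ (P.map (L 1)))
    (heven : ∀ k, φ k = φ (-k)) {σ : EuclideanSpace ℝ (Fin D)} (hσ : σ ≠ 0) {t : ℝ} (ht : 0 < t)
    (s : ℝ) :
    charFun (P.map (fun ω ↦ (inner ℝ σ (L t ω) : ℝ))) s =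
      ((Real.exp (-((‖σ‖ * t ^ α⁻¹) ^ α * (φ (‖σ‖⁻¹ • σ)).re * |s| ^ α)) : ℝ) : ℂ) := by
  have hm1 : AEMeasurable (L 1) P := (hL.tendsto 1 one_pos).aemeasurable_limit
  have hmt : AEMeasurable (L t) P := (hL.tendsto t ht).aemeasurable_limit
  have hσ' : 0 < ‖σ‖ := norm_pos_iff.2 hσ
  have h1 : charFun (P.map (fun ω ↦ (inner ℝ σ (L t ω) : ℝ))) s =
      charFun (P.map (L t)) (s • σ) := by
    rw [charFun_apply_real, charFun_apply, integral_map (by fun_prop) (by fun_prop),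
      integral_map hmt (by fun_prop)]
    simp_rw [inner_smul_right, real_inner_comm]
    push_cast
    rfl
  rw [h1, hL.map_eq_map_smul ht, charFun_map_smul_comp hm1, hφ.charFun_eq,
    hφ.eq_ofReal_re heven, ← Complex.ofReal_neg, ← Complex.ofReal_exp]
  congr 3
  rcases eq_or_ne s 0 with rfl | hs
  · simp [hφ.map_zero, hα.ne']
  have habs : φ (t ^ α⁻¹ • s • σ) = φ ((‖σ‖ * t ^ α⁻¹ * |s|) • ‖σ‖⁻¹ • σ) := by
    have e : (‖σ‖ * t ^ α⁻¹ * |s|) • ‖σ‖⁻¹ • σ = t ^ α⁻¹ • |s| • σ := by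
      rw [smul_smul, smul_smul]
      congr 1
      field_simp
    rw [e]
    rcases abs_choice s with h | h <;> rw [h]
    rw [neg_smul, smul_neg, ← heven]
  have hs' : 0 < |s| := abs_pos.2 hs
  rw [habs, re_negLogCharFun_smul hα hL hφ (by positivity),
    Real.mul_rpow (by positivity) (by positivity)]
  ring

end Projection

/-! ### The moments of the projections -/

theorem mainTheorem3 {D : ℕ} {Ω Ω' : Type*} [MeasurableSpace Ω] [MeasurableSpace Ω']
    (P : Measure Ω) [IsProbabilityMeasure P] (P' : Measure Ω') [IsProbabilityMeasure P']
    (μ : ℝ) (hμ : 0 < μ)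
    (L : ℝ → Ω → EuclideanSpace ℝ (Fin D)) (X : ℕ → Ω' → EuclideanSpace ℝ (Fin D))
    (hL : IsStrictlyOperatorStableLimit P P'
      (((D : ℝ) * μ)⁻¹ • (1 : Matrix (Fin D) (Fin D) ℝ)) L X)
    (φ : EuclideanSpace ℝ (Fin D) → ℂ) (hφ : IsNegLogCharFun φ (P.map (L 1)))
    (hφ_even : ∀ k, φ k = φ (-k))
    (σ : EuclideanSpace ℝ (Fin D)) (hσ : σ ≠ 0) (t : ℝ) (ht : 0 < t) :
    (∀ β : ℝ, -1 < β → β < D * μ → (β < 0 → φ (‖σ‖⁻¹ • σ) ≠ 0) →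
      Integrable (projPow σ (L t) β) P ∧
      (β ≠ 0 →
        ∫ ω, projPow σ (L t) β ω ∂P =
          (fracMomentConst β (D * μ) : ℂ) *
          (((‖σ‖ * t ^ ((D * μ : ℝ)⁻¹)) ^ β : ℝ) : ℂ) *
          ((Real.cos (Real.pi * β / 2) : ℂ) *
            Complex.exp (Complex.I * ((β * Real.pi / 2 : ℝ) : ℂ))) *
          φ (‖σ‖⁻¹ • σ) ^ ((β / (D * μ) : ℝ) : ℂ))) ∧
    ((D : ℝ) * μ < 2 → φ (‖σ‖⁻¹ • σ) ≠ 0 →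
      ∀ β : ℝ, (D : ℝ) * μ ≤ β → ¬ Integrable (projPow σ (L t) β) P) := by
  have hD : 0 < (D : ℝ) := by
    rcases Nat.eq_zero_or_pos D with rfl | h
    · exact absurd (Subsingleton.elim σ 0) hσ
    · exact_mod_cast h
  have hα : 0 < (D : ℝ) * μ := mul_pos hD hμ
  set α := (D : ℝ) * μ
  have hσ' : 0 < ‖σ‖ := norm_pos_iff.2 hσ
  have hm1 : AEMeasurable (L 1) P := (hL.tendsto 1 one_pos).aemeasurable_limit
  have hmt : AEMeasurable (L t) P := (hL.tendsto t ht).aemeasurable_limit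
  have hW : AEMeasurable (fun ω ↦ (inner ℝ σ (L t ω) : ℝ)) P := by fun_prop
  have := Measure.isProbabilityMeasure_map hm1
  have := Measure.isProbabilityMeasure_map hW
  have hν := charFun_map_inner hα hL hφ hφ_even hσ ht
  have hre : φ (‖σ‖⁻¹ • σ) = ((φ (‖σ‖⁻¹ • σ)).re : ℂ) := hφ.eq_ofReal_re hφ_even _
  have hre0 := hφ.re_nonneg (‖σ‖⁻¹ • σ)
  set a := (φ (‖σ‖⁻¹ • σ)).re
  have hb : 0 < ‖σ‖ * t ^ α⁻¹ := by positivity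
  set b := ‖σ‖ * t ^ α⁻¹
  rw [hre]
  have hc : 0 ≤ b ^ α * a := by positivity
  -- Integrability depends on the law of `⟪σ, L t⟫` only.
  have hintegrable : ∀ β : ℝ, Integrable (projPow σ (L t) β) P ↔ Integrable
      (fun x : ℝ ↦ (x : ℂ) ^ (β : ℂ)) (P.map (fun ω ↦ (inner ℝ σ (L t ω) : ℝ))) := fun β ↦
    (integrable_map_measure (aestronglyMeasurable_ofReal_cpow β _) hW).symm
  refine ⟨fun β hβ hβα hβφ ↦ ?_, fun hα2 hφ0 β hβ ↦ ?_⟩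
  · rcases eq_or_ne β 0 with rfl | hβ0
    · refine ⟨?_, fun h ↦ absurd rfl h⟩
      have : projPow σ (L t) 0 = fun _ ↦ 1 := by ext ω; simp [projPow]
      rw [this]
      exact integrable_const _
    · have hcβ : β < 0 → b ^ α * a ≠ 0 := fun h ↦
        mul_ne_zero (by positivity) (by simpa using hβφ h)
      obtain ⟨h1, h2⟩ := integrable_and_integral_ofReal_cpow hc hα hν hβ0 hβ hβα hcβ
      refine ⟨(hintegrable β).2 h1, fun _ ↦ ?_⟩
      rw [integral_map hW (aestronglyMeasurable_ofReal_cpow β _)] at h2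
      simp only [projPow]
      rw [h2, ← Complex.ofReal_cpow hre0, Real.mul_rpow (by positivity) hre0,
        ← Real.rpow_mul hb.le, mul_div_cancel₀ _ hα.ne']
      push_cast
      ring
  · have ha : 0 < a := lt_of_le_of_ne hre0 fun h ↦ hφ0 (by rw [← h, Complex.ofReal_zero])
    rw [hintegrable]
    exact not_integrable_ofReal_cpow (by positivity) hα hα2 hν hβ
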